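/- All objects are germs at the origin of $\mathbb{R}^2$ and of class $C^\infty$. Let $\omega$ be a volume form, $a$ a 1-form, and let $X_a$ be the vector field determined by $\omega(X_a,\cdot)=a$. A conformal symmetry of $a$ is a diffeomorphism germ $\phi:(\mathbb{R}^2,0)\to(\mathbb{R}^2,0)$ with $a=\kappa\cdot\phi^*a$ for some function $\kappa$ with $\kappa(0)\neq0$. Vector fields $X_1,X_2$ are orbitally $a$-conjugate, $X_1\sim X_2$, if $X_1=h\cdot\phi^*X_2$ for some conformal symmetry $\phi$ of $a$ and some function $h$ with $h(0)\ne0$, where $(\phi^*X_2)(x)=(d_x\phi)^{-1}X_2(\phi(x))$. Function germs $f_1,f_2$ are $\mathcal K_a$-equivalent, $f_1\sim f_2$, if $f_1=h\cdot(f_2\circ\phi)$ for some such $\phi$ and $h$. Let $\mathcal E$ be the ring of smooth function germs at the origin. The codimension (with respect to $\mathcal K_a$-equivalence) of $f\in\mathcal E$, of the curve $\{f=0\}$ and of the vector field $f\cdot X_a$ is $\mathrm{codim}(f)=\dim_{\mathbb R}\mathcal E/\langle f,\mathcal L_{X_a}f\rangle$. The $k$-jet $j^kf$ is the Taylor polynomial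 of $f$ at the origin of degree at most $k$. **Theorem (on singular 1-forms).** Let $a$ be a singular 1-form, i.e. $a(0)=0$, and let $X=f\cdot X_a$ with $f\in\mathcal E$. 1. If $f(0)\neq0$, then $X\sim X_a$, and the equivalence class has codimension $0$: $\mathrm{codim}(f)=0$, and $\mathrm{codim}(g)=0$ for every $g\in\mathcal E$ with $g\sim f$. 2. If $f(0)=0$ and the curve $\{f=0\}$ has finite codimension $k$, i.e. $\mathrm{codim}(f)=k<\infty$, then $f\sim j^kf$, hence $X\sim j^kf\cdot X_a$. Moreover $f$ is $k$-determined: $f\sim g$ for every $g\in\mathcal E$ with $j^kg=j^kf$. -/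

import Mathlib

open Filter Topology
open scoped ContDiff

noncomputable section

namespace PlaneGerm

/-- The plane `ℝ²`, with base point the origin. Germs at the origin of functions, vector fields,
forms and maps are handled through representatives defined on the whole plane, of which only the
restriction to a neighbourhood of the origin matters. -/
abbrev Plane : Type := ℝ × ℝ

/-- The map `g` is `C^∞` on some neighbourhood of the origin. -/
def Smooth {F : Type*} [NormedAddCommGroup F] [NormedSpace ℝ F] (g : Plane → F) : Prop :=
  ∀ᶠ x in 𝓝 (0 : Plane), ContDiffAt ℝ ∞ g x

/-- A "non-zero function": a smooth function germ that does not vanish at (equivalently, near)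
the origin. -/
def NonvanishingGerm (h : Plane → ℝ) : Prop :=
  Smooth h ∧ h 0 ≠ 0

/-- A volume form near the origin: a smooth, non-vanishing 2-form. -/
def IsVolumeForm (Ω : Plane → Plane [⋀^Fin 2]→L[ℝ] ℝ) : Prop :=
  Smooth Ω ∧ Ω 0 ≠ 0

/-- A germ at the origin of diffeomorphism `(ℝ², 0) → (ℝ², 0)`. -/
def IsDiffeoGerm (φ : Plane → Plane) : Prop :=
  Smooth φ ∧ φ 0 = 0 ∧ ∃ ψ : Plane → Plane, Smooth ψ ∧ ψ 0 = 0 ∧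
    (∀ᶠ x in 𝓝 (0 : Plane), ψ (φ x) = x) ∧ (∀ᶠ x in 𝓝 (0 : Plane), φ (ψ x) = x)

/-- Pullback `φ^*b` of a 1-form. -/
def pullbackForm (φ : Plane → Plane) (b : Plane → Plane →L[ℝ] ℝ) : Plane → Plane →L[ℝ] ℝ :=
  fun x => (b (φ x)).comp (fderiv ℝ φ x)

/-- The diffeomorphism germ `φ` is a conformal equivalence of the 1-forms `a` and `b`:
`a = k • φ^*b` for a non-vanishing function germ `k`. -/
def IsConformalEquiv (a b : Plane → Plane →L[ℝ] ℝ) (φ : Plane → Plane) : Prop :=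
  IsDiffeoGerm φ ∧ ∃ k : Plane → ℝ, NonvanishingGerm k ∧
    ∀ᶠ x in 𝓝 (0 : Plane), a x = k x • pullbackForm φ b x

/-- Orbital `(a,b)`-conjugacy of the germs of vector fields `X₁`, `X₂`: `X₁ = h • φ^*X₂`
for a non-vanishing function germ `h` and a conformal equivalence `φ` of `a` and `b`. -/
def OrbitallyConj (a b : Plane → Plane →L[ℝ] ℝ) (X₁ X₂ : Plane → Plane) : Prop :=
  ∃ φ : Plane → Plane, IsConformalEquiv a b φ ∧ ∃ h : Plane → ℝ, NonvanishingGerm h ∧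
    ∀ᶠ x in 𝓝 (0 : Plane), X₁ x = h x • VectorField.pullback ℝ φ X₂ x

/-- `𝒦_{(a,b)}`-equivalence of function germs: `f₁ = h • φ^*f₂` for a non-vanishing function
germ `h` and a conformal equivalence `φ` of `a` and `b`. -/
def KEquiv (a b : Plane → Plane →L[ℝ] ℝ) (f₁ f₂ : Plane → ℝ) : Prop :=
  ∃ φ : Plane → Plane, IsConformalEquiv a b φ ∧ ∃ h : Plane → ℝ, NonvanishingGerm h ∧
    ∀ᶠ x in 𝓝 (0 : Plane), f₁ x = h x * f₂ (φ x)

/-- The vector field `X_a` determined by the 1-form `a` and the volume form `Ω` through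
`Ω(X_a, ·) = a` (see `volume_assocField` and `assocField_unique`). -/
def assocField (Ω : Plane → Plane [⋀^Fin 2]→L[ℝ] ℝ) (a : Plane → Plane →L[ℝ] ℝ) :
    Plane → Plane :=
  fun x => (a x (0, 1) / Ω x ![(1, 0), (0, 1)], - a x (1, 0) / Ω x ![(1, 0), (0, 1)])

theorem twoForm_apply (η : Plane [⋀^Fin 2]→L[ℝ] ℝ) (v w : Plane) :
    η ![v, w] = η ![(1, 0), (0, 1)] * (v.1 * w.2 - v.2 * w.1) := by
  have h := congrArg (fun g => g ![v, w])
    (η.toAlternatingMap.eq_smul_basis_det (Module.Basis.finTwoProd ℝ))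
  have hb : (⇑(Module.Basis.finTwoProd ℝ) : Fin 2 → Plane) = ![(1, 0), (0, 1)] := by
    ext i <;> fin_cases i <;> simp
  rw [hb] at h
  simp [Module.Basis.det_apply, Matrix.det_fin_two, Module.Basis.toMatrix_apply] at h
  rw [h]
  ring

theorem twoForm_basis_ne_zero {η : Plane [⋀^Fin 2]→L[ℝ] ℝ} (h : η ≠ 0) :
    η ![(1, 0), (0, 1)] ≠ 0 := by
  intro h0
  apply h
  ext u
  have hu : u = ![u 0, u 1] := by ext i <;> fin_cases i <;> rfl
  rw [hu, twoForm_apply, h0]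
  simp

theorem IsVolumeForm.eventually_basis_ne_zero {Ω : Plane → Plane [⋀^Fin 2]→L[ℝ] ℝ}
    (hΩ : IsVolumeForm Ω) : ∀ᶠ x in 𝓝 (0 : Plane), Ω x ![(1, 0), (0, 1)] ≠ 0 := by
  filter_upwards [hΩ.1.self_of_nhds.continuousAt.eventually_ne hΩ.2] with x hx
  exact twoForm_basis_ne_zero hx

/-- The defining equation `X_a ⌟ Ω = a`, near the origin. -/
theorem volume_assocField {Ω : Plane → Plane [⋀^Fin 2]→L[ℝ] ℝ} (hΩ : IsVolumeForm Ω)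
    (a : Plane → Plane →L[ℝ] ℝ) :
    ∀ᶠ x in 𝓝 (0 : Plane), ∀ v : Plane, Ω x ![assocField Ω a x, v] = a x v := by
  filter_upwards [hΩ.eventually_basis_ne_zero] with x hx v
  have hv : a x v = v.1 * a x (1, 0) + v.2 * a x (0, 1) := by
    have : v = v.1 • ((1, 0) : Plane) + v.2 • ((0, 1) : Plane) := by ext <;> simp
    conv_lhs => rw [this, map_add, map_smul, map_smul]
    simp
  rw [twoForm_apply, hv, assocField]
  field_simp
  ring

/-- `X_a` is the only germ of vector field with `X_a ⌟ Ω = a`. -/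
theorem assocField_unique {Ω : Plane → Plane [⋀^Fin 2]→L[ℝ] ℝ} (hΩ : IsVolumeForm Ω)
    (a : Plane → Plane →L[ℝ] ℝ) (Y : Plane → Plane)
    (hY : ∀ᶠ x in 𝓝 (0 : Plane), ∀ v : Plane, Ω x ![Y x, v] = a x v) :
    Y =ᶠ[𝓝 0] assocField Ω a := by
  filter_upwards [hΩ.eventually_basis_ne_zero, hY] with x hx hYx
  have h1 := hYx (1, 0)
  have h2 := hYx (0, 1)
  rw [twoForm_apply] at h1 h2
  simp only [assocField]
  ext
  · simp only [← h2]; field_simp; ring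
  · simp only [← h1]; field_simp; ring

theorem smooth_assocField {Ω : Plane → Plane [⋀^Fin 2]→L[ℝ] ℝ} {a : Plane → Plane →L[ℝ] ℝ}
    (hΩ : IsVolumeForm Ω) (ha : Smooth a) : Smooth (assocField Ω a) := by
  filter_upwards [hΩ.eventually_basis_ne_zero, hΩ.1, ha] with x hx hΩx hax
  have hW : ContDiffAt ℝ ∞ (fun y => Ω y ![(1, 0), (0, 1)]) x :=
    (ContinuousAlternatingMap.apply ℝ Plane ℝ ![(1, 0), (0, 1)]).contDiff.contDiffAt.comp x hΩx
  have h1 : ContDiffAt ℝ ∞ (fun y => a y (0, 1)) x := hax.clm_apply contDiffAt_const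
  have h2 : ContDiffAt ℝ ∞ (fun y => a y (1, 0)) x := hax.clm_apply contDiffAt_const
  exact (h1.div hW hx).prodMk (h2.neg.div hW hx)

/-- The Lie derivative `ℒ_X f` of a function. -/
def lieDeriv (X : Plane → Plane) (f : Plane → ℝ) : Plane → ℝ :=
  fun x => fderiv ℝ f x (X x)

theorem smooth_lieDeriv {X : Plane → Plane} {f : Plane → ℝ} (hX : Smooth X) (hf : Smooth f) :
    Smooth (lieDeriv X f) := by
  filter_upwards [hX, hf] with x hXx hfx
  exact (hfx.fderiv_right (m := ∞) (by simp)).clm_apply hXx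

/-- The ring `ℰ` of germs at the origin of smooth functions. -/
def smoothGerms : Subring (Germ (𝓝 (0 : Plane)) ℝ) where
  carrier := {g | ∃ f : Plane → ℝ, Smooth f ∧ (f : Germ (𝓝 (0 : Plane)) ℝ) = g}
  mul_mem' := by
    rintro _ _ ⟨f, hf, rfl⟩ ⟨g, hg, rfl⟩
    exact ⟨f * g, by filter_upwards [hf, hg] with x h1 h2 using h1.mul h2, rfl⟩
  one_mem' := ⟨fun _ => 1, Eventually.of_forall fun _ => contDiffAt_const, rfl⟩
  add_mem' := by
    rintro _ _ ⟨f, hf, rfl⟩ ⟨g, hg, rfl⟩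
    exact ⟨f + g, by filter_upwards [hf, hg] with x h1 h2 using h1.add h2, rfl⟩
  zero_mem' := ⟨fun _ => 0, Eventually.of_forall fun _ => contDiffAt_const, rfl⟩
  neg_mem' := by
    rintro _ ⟨f, hf, rfl⟩
    exact ⟨-f, by filter_upwards [hf] with x h1 using h1.neg, rfl⟩

/-- The germ at the origin of a smooth function. -/
def toGerm (f : Plane → ℝ) (hf : Smooth f) : smoothGerms :=
  ⟨(f : Germ (𝓝 (0 : Plane)) ℝ), f, hf, rfl⟩

/-- `ℰ` is a real algebra, through the constant functions. -/
instance : Algebra ℝ smoothGerms :=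
  RingHom.toAlgebra
    { toFun := fun c => toGerm (fun _ => c) (Eventually.of_forall fun _ => contDiffAt_const)
      map_one' := rfl
      map_mul' := fun _ _ => rfl
      map_zero' := rfl
      map_add' := fun _ _ => rfl }

/-- The tangent space `⟨f, ℒ_{X_a} f⟩` at `f` of the `𝒦_a`-class of `f`, an ideal of `ℰ`. -/
def tangentIdeal {Ω : Plane → Plane [⋀^Fin 2]→L[ℝ] ℝ} {a : Plane → Plane →L[ℝ] ℝ}
    {f : Plane → ℝ} (hΩ : IsVolumeForm Ω) (ha : Smooth a) (hf : Smooth f) : Ideal smoothGerms :=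
  Ideal.span {toGerm f hf,
    toGerm (lieDeriv (assocField Ω a) f) (smooth_lieDeriv (smooth_assocField hΩ ha) hf)}

/-- The codimension `dim_ℝ (ℰ / ⟨f, ℒ_{X_a} f⟩)` of `f` (of the curve `{f = 0}`, of the vector
field `f • X_a`) with respect to `𝒦_a`-equivalence. -/
def codim {Ω : Plane → Plane [⋀^Fin 2]→L[ℝ] ℝ} {a : Plane → Plane →L[ℝ] ℝ}
    {f : Plane → ℝ} (hΩ : IsVolumeForm Ω) (ha : Smooth a) (hf : Smooth f) : Cardinal :=
  Module.rank ℝ (smoothGerms ⧸ tangentIdeal hΩ ha hf)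

/-- The `k`-jet `j^k f` at the origin, as the Taylor polynomial of degree at most `k`. -/
def jet (k : ℕ) (f : Plane → ℝ) : Plane → ℝ :=
  fun x => ∑ i ∈ Finset.range (k + 1),
    (i.factorial : ℝ)⁻¹ * iteratedFDeriv ℝ i f 0 (fun _ => x)

end PlaneGerm

end

open PlaneGerm

/-! If `f 0 ≠ 0`, then `f` is a unit, and the identity map with factor `f` gives `f ∼ 1`. The rest
is the homotopy method. Write `X` for the field `X_a`, `𝔪` for the ideal of germs vanishing at the
origin, `T = ⟨f, ℒ_X f⟩`, and `g = f + p` with `p ∈ 𝔪^(k+1)`; by Taylor's formula (`sub_jet_mem`)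
this covers every `g` with the `k`-jet of `f`.

Algebra: since `ℰ/T` has dimension `k`, Nakayama gives `𝔪^k ⊆ T`, so `𝔪^(k+1) ⊆ 𝔪T`. As `X` vanishes
at the origin, `ℒ_X` preserves `𝔪^(k+1)`. Hence `p` and `ℒ_X p` are combinations of `f` and `ℒ_X f`
with coefficients in `𝔪`, and Cramer's rule solves `p + u ℒ_X(f + tp) + v (f + tp) = 0` with `u(t,
0) = 0`, uniformly for `t ∈ [0, 1]` (`kEquiv_of_sub_mem`).

Geometry: the time-one flow of `uX` carries `f` to `f + p` up to a factor
(`kEquiv_of_infinitesimal`). It is conformal: `a(X) = 0` and `da` is a multiple of the volume form,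
so `ℒ_X a = μa` and `ℒ_{uX} a = uμa` (`lie_form_eq`, `exists_conformal_flow`).

Analysis: `uX` vanishes to second order at the origin, so on the Banach space of continuous paths
the integral equation of the flow has the identity as linear part at the zero path. The inverse
function theorem solves it up to time one, smoothly in the initial point (`exists_flow`). -/

noncomputable section

namespace PlaneGerm

open scoped unitInterval

/-! ### Smoothness of superposition operators on path spaces -/

section Nemytskii

universe u
set_option linter.unusedSectionVars false

variable {E F : Type u} [NormedAddCommGroup E] [NormedSpace ℝ E]
  [NormedAddCommGroup F] [NormedSpace ℝ F]

/-- The superposition (Nemytskii) operator `γ ↦ (s ↦ G (s, γ s))` on paths. -/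
def superpose (G : ℝ × E → F) (hG : Continuous G) (γ : C(I, E)) : C(I, F) :=
  ⟨fun s => G (s, γ s), by fun_prop⟩

@[simp]
theorem superpose_apply (G : ℝ × E → F) (hG : Continuous G) (γ : C(I, E)) (s : I) :
    superpose G hG γ s = G (s, γ s) := rfl

theorem continuous_superpose (G : ℝ × E → F) (hG : Continuous G) :
    Continuous (superpose G hG) := by
  apply ContinuousMap.continuous_of_continuous_uncurry
  have : Continuous fun q : C(I, E) × I => G ((q.2 : ℝ), q.1 q.2) := by fun_prop
  exact this

/-- Pointwise application of a path of operators to a path of vectors. -/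
def pathApply : C(I, E →L[ℝ] F) →L[ℝ] C(I, E) →L[ℝ] C(I, F) :=
  LinearMap.mkContinuous₂
    (LinearMap.mk₂ ℝ (fun (A : C(I, E →L[ℝ] F)) (η : C(I, E)) =>
      (⟨fun s => A s (η s), by fun_prop⟩ : C(I, F)))
      (fun _ _ _ => by ext; simp) (fun _ _ _ => by ext; simp)
      (fun _ _ _ => by ext; simp) (fun _ _ _ => by ext; simp)) 1
    (fun A η => by
      rw [one_mul, ContinuousMap.norm_le _ (by positivity)]
      intro s
      exact (A s).le_of_opNorm_le_of_le (A.norm_coe_le_norm s) (η.norm_coe_le_norm s))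

@[simp]
theorem pathApply_apply (A : C(I, E →L[ℝ] F)) (η : C(I, E)) (s : I) :
    pathApply A η s = A s (η s) := rfl

/-- The partial derivative in the second variable. -/
def partialSnd (G : ℝ × E → F) : ℝ × E → E →L[ℝ] F :=
  fun q => (fderiv ℝ G q).comp (ContinuousLinearMap.inr ℝ ℝ E)

theorem contDiff_partialSnd {G : ℝ × E → F} (hG : ContDiff ℝ ∞ G) :
    ContDiff ℝ ∞ (partialSnd G) :=
  (hG.fderiv_right (m := ∞) (by simp)).clm_comp contDiff_const

theorem hasFDerivAt_partialSnd {G : ℝ × E → F} (hG : ContDiff ℝ ∞ G) (s : ℝ) (x : E) :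
    HasFDerivAt (fun y => G (s, y)) (partialSnd G (s, x)) x :=
  ((hG.differentiable (by simp) (s, x)).hasFDerivAt).comp x (hasFDerivAt_prodMk_right s x)

/-- The mean value inequality at each time `s` gives the estimate; its constant is uniform in `s`
because superposition with the partial derivative is continuous for the sup norm. -/
theorem hasFDerivAt_superpose {G : ℝ × E → F} (hG : ContDiff ℝ ∞ G) (γ : C(I, E)) :
    HasFDerivAt (superpose G hG.continuous)
      (pathApply (superpose (partialSnd G) (contDiff_partialSnd hG).continuous γ)) γ := by
  rw [hasFDerivAt_iff_isLittleO, Asymptotics.isLittleO_iff]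
  intro ε hε
  have hc := (continuous_superpose (partialSnd G) (contDiff_partialSnd hG).continuous).continuousAt
    (x := γ)
  rw [Metric.continuousAt_iff] at hc
  obtain ⟨δ, hδ, hc⟩ := hc ε hε
  filter_upwards [Metric.ball_mem_nhds γ hδ] with ξ hξ
  rw [ContinuousMap.norm_le _ (by positivity)]
  intro s
  have key := (convex_ball (γ s) δ).norm_image_sub_le_of_norm_hasFDerivWithin_le'
    (f := fun y => G ((s : ℝ), y)) (f' := fun y => partialSnd G ((s : ℝ), y))
    (φ := partialSnd G ((s : ℝ), γ s)) (C := ε) (x := γ s) (y := ξ s)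
    (fun y _ => (hasFDerivAt_partialSnd hG s y).hasFDerivWithinAt) (fun y hy => by
      -- The translate of `γ` that passes through `y` at time `s` stays within `δ` of `γ`, so
      -- continuity on path space yields the pointwise bound at `y`.
      have h1 : dist (γ + ContinuousMap.const I (y - γ s)) γ < δ := by
        rw [dist_eq_norm, add_sub_cancel_left]
        rw [ContinuousMap.norm_lt_iff _ hδ]
        intro _
        simpa [dist_eq_norm] using hy
      have h2 := (ContinuousMap.dist_apply_le_dist s).trans (hc h1).le
      rw [dist_eq_norm] at h2
      simpa using h2) (Metric.mem_ball_self hδ)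
    ((ContinuousMap.dist_apply_le_dist s).trans_lt hξ)
  refine key.trans ?_
  gcongr
  exact (ξ - γ).norm_coe_le_norm s

/-- The derivative is again a superposition operator, followed by a bounded linear map, so induction
on the order works once the target varies. The common universe of `E` and `F` keeps `E →L[ℝ] F`
among the admissible targets. -/
theorem contDiff_superpose {G : ℝ × E → F} (hG : ContDiff ℝ ∞ G) :
    ContDiff ℝ ∞ (superpose G hG.continuous) := by
  rw [contDiff_infty]
  intro n
  induction n generalizing F with
  | zero => exact contDiff_zero.2 (continuous_superpose _ _)
  | succ n ih =>
    rw [Nat.cast_add, Nat.cast_one, contDiff_succ_iff_hasFDerivAt]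
    exact ⟨_, ContDiff.comp (g := ⇑(pathApply (E := E) (F := F)))
      (ContinuousLinearMap.contDiff _) (ih (contDiff_partialSnd hG)), hasFDerivAt_superpose hG⟩

end Nemytskii

/-! ### The Volterra operator -/

section Volterra

set_option linter.unusedSectionVars false

variable {F : Type*} [NormedAddCommGroup F] [NormedSpace ℝ F]

/-- A path extended to the line by its end values. -/
def extendPath (γ : C(I, F)) (s : ℝ) : F := γ (Set.projIcc 0 1 zero_le_one s)

theorem continuous_extendPath (γ : C(I, F)) : Continuous (extendPath γ) :=
  γ.continuous.comp continuous_projIcc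

theorem extendPath_of_mem (γ : C(I, F)) {s : ℝ} (hs : s ∈ Set.Icc (0 : ℝ) 1) :
    extendPath γ s = γ ⟨s, hs⟩ := by
  rw [extendPath, Set.projIcc_of_mem _ hs]

/-- The Volterra operator `γ ↦ (t ↦ ∫₀ᵗ γ)`. -/
def volterra : C(I, F) →L[ℝ] C(I, F) :=
  LinearMap.mkContinuous
    { toFun := fun γ => ⟨fun t => ∫ s in (0 : ℝ)..t, extendPath γ s,
        (intervalIntegral.continuous_primitive
          (fun a b => (continuous_extendPath γ).intervalIntegrable a b) 0).comp
          continuous_subtype_val⟩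
      map_add' := fun γ η => by
        ext t
        exact intervalIntegral.integral_add ((continuous_extendPath γ).intervalIntegrable _ _)
          ((continuous_extendPath η).intervalIntegrable _ _)
      map_smul' := fun c γ => by
        ext t
        exact intervalIntegral.integral_smul c (extendPath γ) } 1
    (fun γ => by
      rw [one_mul, ContinuousMap.norm_le _ (norm_nonneg _)]
      intro t
      have := intervalIntegral.norm_integral_le_of_norm_le_const (a := 0) (b := (t : ℝ))
        (f := extendPath γ) (C := ‖γ‖) (fun s _ => γ.norm_coe_le_norm _)
      refine this.trans ?_
      rw [sub_zero, abs_of_nonneg t.2.1]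
      exact mul_le_of_le_one_right (norm_nonneg _) t.2.2)

end Volterra

/-! ### Inverse functions and flows -/

/-- The inverse function theorem for a smooth germ tangent to the identity. -/
theorem exists_smooth_inverse {E : Type*} [NormedAddCommGroup E] [NormedSpace ℝ E]
    [CompleteSpace E] {f : E → E} (hf : ∀ᶠ x in 𝓝 0, ContDiffAt ℝ ∞ f x) (h0 : f 0 = 0)
    (hd : HasFDerivAt f (ContinuousLinearMap.id ℝ E) 0) :
    ∃ g : E → E, (∀ᶠ x in 𝓝 0, ContDiffAt ℝ ∞ g x) ∧ g 0 = 0 ∧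
      (∀ᶠ x in 𝓝 0, g (f x) = x) ∧ ∀ᶠ x in 𝓝 0, f (g x) = x := by
  have hf0 := hf.self_of_nhds
  have hd' : HasFDerivAt f ((ContinuousLinearEquiv.refl ℝ E : E ≃L[ℝ] E) : E →L[ℝ] E) 0 := hd
  let e := hf0.toOpenPartialHomeomorph f hd' (by simp)
  have he : (e : E → E) = f := rfl
  have hs : (0 : E) ∈ e.source := hf0.mem_toOpenPartialHomeomorph_source hd' (by simp)
  have ht : (0 : E) ∈ e.target := by
    have := e.map_source hs
    rwa [he, h0] at this
  have hg0 : e.symm 0 = 0 := by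
    have := e.left_inv hs
    rwa [he, h0] at this
  have hu : ∀ᶠ x in 𝓝 (0 : E), IsUnit (fderiv ℝ f x) := by
    have hc : ContinuousAt (fderiv ℝ f) 0 :=
      (hf0.fderiv_right (m := 0) (by simp)).continuousAt
    refine hc.eventually (Units.isOpen.mem_nhds ?_)
    rw [hd.fderiv]
    exact isUnit_one
  have hcg : Tendsto e.symm (𝓝 0) (𝓝 0) := by
    have := (e.continuousAt_symm ht).tendsto
    rwa [hg0] at this
  refine ⟨e.symm, ?_, hg0, ?_, ?_⟩
  · filter_upwards [hcg.eventually (hf.and hu), e.open_target.mem_nhds ht] with y ⟨h1, u, h2⟩ hy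
    refine e.contDiffAt_symm (f₀' := ContinuousLinearEquiv.ofUnit u) hy ?_ h1
    have := (h1.differentiableAt (by simp)).hasFDerivAt
    rw [← h2] at this
    exact this
  · filter_upwards [e.open_source.mem_nhds hs] with x hx using e.left_inv hx
  · filter_upwards [e.open_target.mem_nhds ht] with x hx using e.right_inv hx

/-- The flow, up to time one, of a time-dependent vector field that vanishes to second order along
the time axis: it depends smoothly on the initial condition, and its derivative solves the
linearized equation. -/
theorem exists_flow {E : Type*} [NormedAddCommGroup E] [NormedSpace ℝ E] [CompleteSpace E]
    {Y : ℝ × E → E} (hY : ContDiff ℝ ∞ Y) (hY0 : ∀ s, Y (s, 0) = 0)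
    (hY1 : ∀ s, partialSnd Y (s, 0) = 0) :
    ∃ Γ : E → C(I, E), (∀ᶠ x in 𝓝 0, ContDiffAt ℝ ∞ Γ x) ∧ Γ 0 = 0 ∧
      (∀ᶠ x in 𝓝 0, Γ x = ContinuousMap.const I x + volterra (superpose Y hY.continuous (Γ x))) ∧
      ∀ᶠ x in 𝓝 0, ∀ v, fderiv ℝ Γ x v = ContinuousMap.const I v +
        volterra (pathApply (superpose (partialSnd Y) (contDiff_partialSnd hY).continuous (Γ x))
          (fderiv ℝ Γ x v)) := by
  let N := superpose Y hY.continuous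
  let D := superpose (partialSnd Y) (contDiff_partialSnd hY).continuous
  have hN : ContDiff ℝ ∞ N := contDiff_superpose hY
  let V : C(I, E) →L[ℝ] C(I, E) := volterra
  let Ψ : C(I, E) → C(I, E) := fun γ => γ - V (N γ)
  have hΨ : ContDiff ℝ ∞ Ψ := contDiff_id.sub (V.contDiff.comp hN)
  have hΨd : ∀ γ, HasFDerivAt Ψ
      (ContinuousLinearMap.id ℝ _ - V.comp (pathApply (D γ))) γ := fun γ =>
    (hasFDerivAt_id γ).sub (V.hasFDerivAt.comp γ (hasFDerivAt_superpose hY γ))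
  have hN0 : N 0 = 0 := by ext s; simp [N, hY0]
  have hD0 : D 0 = 0 := by ext s : 1; simp [D, hY1]
  have hΨ0 : Ψ 0 = 0 := by simp [Ψ, hN0]
  have hΨd0 := hΨd 0
  rw [hD0, map_zero, ContinuousLinearMap.comp_zero, sub_zero] at hΨd0
  obtain ⟨Θ, hΘ, hΘ0, -, hΨΘ⟩ :=
    exists_smooth_inverse (Eventually.of_forall fun γ => hΨ.contDiffAt) hΨ0 hΨd0
  let c : E →L[ℝ] C(I, E) := ContinuousLinearMap.const ℝ I
  have hc : ∀ x, c x = ContinuousMap.const I x := fun x => rfl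
  have hc0 : Tendsto c (𝓝 0) (𝓝 0) := by
    have := c.continuous.tendsto 0
    rwa [map_zero] at this
  have hsm : ∀ᶠ x in 𝓝 0, ContDiffAt ℝ ∞ (fun x => Θ (c x)) x := by
    filter_upwards [hc0.eventually hΘ] with x hx using hx.comp x c.contDiff.contDiffAt
  refine ⟨fun x => Θ (c x), hsm, by simp [hΘ0], ?_, ?_⟩
  · filter_upwards [hc0.eventually hΨΘ] with x hx
    exact (sub_eq_iff_eq_add.1 hx).trans rfl
  · filter_upwards [hsm, (hc0.eventually hΨΘ).eventually_nhds] with x hx hxe v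
    have h1 := ((hx.differentiableAt (by simp)).hasFDerivAt)
    -- Differentiating `Ψ (Θ (c x)) = c x` in `x` gives the linearized equation.
    have h2 := ((hΨd _).comp x h1).congr_of_eventuallyEq
      (f₁ := c) (by filter_upwards [hxe] with y hy using hy.symm)
    have h3 := h2.unique c.hasFDerivAt
    have h4 := congrArg (fun A : E →L[ℝ] C(I, E) => A v) h3
    exact sub_eq_iff_eq_add.1 h4

/-! ### Global representatives and Taylor's formula -/

theorem smooth_of_contDiff {F : Type*} [NormedAddCommGroup F] [NormedSpace ℝ F] {g : Plane → F}
    (hg : ContDiff ℝ ∞ g) : Smooth g :=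
  Eventually.of_forall fun _ => hg.contDiffAt

theorem Smooth.congr {F : Type*} [NormedAddCommGroup F] [NormedSpace ℝ F] {f g : Plane → F}
    (hf : Smooth f) (h : f =ᶠ[𝓝 0] g) : Smooth g := by
  filter_upwards [hf, h.eventually_nhds] with x hx hxe
  exact hx.congr_of_eventuallyEq (by filter_upwards [hxe] with y hy using hy.symm)

/-- A smooth germ has a representative that is smooth on the whole plane. -/
theorem Smooth.exists_contDiff {F : Type*} [NormedAddCommGroup F] [NormedSpace ℝ F]
    {f : Plane → F} (hf : Smooth f) : ∃ g : Plane → F, ContDiff ℝ ∞ g ∧ g =ᶠ[𝓝 0] f := by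
  obtain ⟨r, hr, hfr⟩ := Metric.eventually_nhds_iff_ball.1 hf
  let b : ContDiffBump (0 : Plane) := ⟨r / 3, r / 2, by positivity, by linarith⟩
  refine ⟨fun x => b x • f x, contDiff_iff_contDiffAt.2 fun x => ?_, ?_⟩
  · by_cases hx : x ∈ Metric.ball (0 : Plane) r
    · exact b.contDiff.contDiffAt.smul (hfr x hx)
    · have hx' : x ∉ tsupport b := by
        rw [b.tsupport_eq]
        intro h
        apply hx
        rw [Metric.mem_closedBall] at h
        rw [Metric.mem_ball]
        exact h.trans_lt (by change r / 2 < r; linarith)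
      have h0 : (fun y => b y • f y) =ᶠ[𝓝 x] fun _ => 0 := by
        filter_upwards [(isClosed_tsupport b).isOpen_compl.mem_nhds hx'] with y hy
        rw [image_eq_zero_of_notMem_tsupport hy, zero_smul]
      exact contDiffAt_const.congr_of_eventuallyEq h0
  · filter_upwards [b.eventuallyEq_one] with x hx
    rw [hx, Pi.one_apply, one_smul]

/-- The integral is the value at time one of the Volterra operator on the superposition of `G` with
a constant path, a composite of smooth maps. -/
theorem contDiff_integral {G : ℝ × Plane → ℝ} (hG : ContDiff ℝ ∞ G) :
    ContDiff ℝ ∞ fun x : Plane => ∫ t in (0 : ℝ)..1, G (t, x) := by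
  let V : C(I, ℝ) →L[ℝ] C(I, ℝ) := volterra
  let ev : C(I, ℝ) →L[ℝ] ℝ := ContinuousMap.evalCLM ℝ (1 : I)
  let c : Plane →L[ℝ] C(I, Plane) := ContinuousLinearMap.const ℝ I
  have h1 : ContDiff ℝ ∞ fun x : Plane => ev (V (superpose G hG.continuous (c x))) :=
    ev.contDiff.comp (V.contDiff.comp ((contDiff_superpose hG).comp c.contDiff))
  convert h1 using 2 with x
  refine intervalIntegral.integral_congr fun t ht => ?_
  rw [Set.uIcc_of_le zero_le_one] at ht
  exact (extendPath_of_mem (superpose G hG.continuous (c x)) ht).symm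

theorem iteratedDeriv_comp_smul {E F : Type*} [NormedAddCommGroup E] [NormedSpace ℝ E]
    [NormedAddCommGroup F] [NormedSpace ℝ F] {f : E → F} (hf : ContDiff ℝ ∞ f) (x : E) (n : ℕ) :
    iteratedDeriv n (fun s : ℝ => f (s • x)) = fun s => iteratedFDeriv ℝ n f (s • x) fun _ => x := by
  induction n with
  | zero => ext s; simp
  | succ n ih =>
    ext s
    rw [iteratedDeriv_succ, ih, iteratedFDeriv_succ_apply_left]
    have h1 : HasFDerivAt (iteratedFDeriv ℝ n f) (fderiv ℝ (iteratedFDeriv ℝ n f) (s • x)) (s • x) :=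
      ((hf.differentiable_iteratedFDeriv (m := n) (by exact_mod_cast WithTop.coe_lt_top _))
        _).hasFDerivAt
    have h2 : HasDerivAt (fun s : ℝ => s • x) x s := by
      simpa using (hasDerivAt_id s).smul_const x
    have h3 := h1.comp_hasDerivAt s h2
    exact ((ContinuousMultilinearMap.apply ℝ (fun _ : Fin n => E) F
      (fun _ => x)).hasFDerivAt.comp_hasDerivAt s h3).deriv

/-- Taylor's formula on rays through the origin. -/
theorem sub_jet_eq_integral {f : Plane → ℝ} (hf : ContDiff ℝ ∞ f) (k : ℕ) (x : Plane) :
    f x - jet k f x = ∫ t in (0 : ℝ)..1,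
      ((1 - t) ^ k / k.factorial) * iteratedFDeriv ℝ (k + 1) f (t • x) fun _ => x := by
  have hg : ContDiff ℝ ∞ (fun s : ℝ => f (s • x)) := by fun_prop
  have hu : UniqueDiffOn ℝ (Set.uIcc (0 : ℝ) 1) := uniqueDiffOn_uIcc zero_ne_one
  have hi : ∀ n : ℕ, ∀ t ∈ Set.uIcc (0 : ℝ) 1,
      iteratedDerivWithin n (fun s : ℝ => f (s • x)) (Set.uIcc 0 1) t =
        iteratedFDeriv ℝ n f (t • x) fun _ => x := by
    intro n t ht
    rw [iteratedDerivWithin_eq_iteratedDeriv hu ((hg.of_le (by exact_mod_cast le_top)).contDiffAt) ht,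
      iteratedDeriv_comp_smul hf]
  have h := taylor_integral_remainder (n := k) (x₀ := 0) (x := 1)
    (f := fun s : ℝ => f (s • x)) ((hg.of_le (by exact_mod_cast le_top)).contDiffOn)
  rw [taylor_within_apply, one_smul] at h
  rw [jet]
  convert h using 1
  · congr 1
    refine Finset.sum_congr rfl fun i _ => ?_
    rw [hi i 0 (by simp)]
    simp
  · refine intervalIntegral.integral_congr fun t ht => ?_
    simp only [smul_eq_mul]
    rw [hi _ t ht]

theorem contDiff_jet (k : ℕ) (f : Plane → ℝ) : ContDiff ℝ ∞ (jet k f) := by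
  refine ContDiff.sum fun i _ => contDiff_const.mul ?_
  exact (iteratedFDeriv ℝ i f 0).contDiff.comp (by fun_prop)

/-! ### The local ring of germs and Hadamard's lemma -/

/-- The ring of functions that are smooth near the origin. -/
def smoothFunctions : Subring (Plane → ℝ) where
  carrier := {f | Smooth f}
  mul_mem' hf hg := by filter_upwards [hf, hg] with x h1 h2 using h1.mul h2
  one_mem' := Eventually.of_forall fun _ => contDiffAt_const
  add_mem' hf hg := by filter_upwards [hf, hg] with x h1 h2 using h1.add h2
  zero_mem' := Eventually.of_forall fun _ => contDiffAt_const
  neg_mem' hf := by filter_upwards [hf] with x h1 using h1.neg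

/-- Passing to germs, as a ring homomorphism. -/
def germHom : smoothFunctions →+* smoothGerms where
  toFun f := toGerm f.1 f.2
  map_one' := rfl
  map_mul' _ _ := rfl
  map_zero' := rfl
  map_add' _ _ := rfl

theorem toGerm_eq_iff {f g : Plane → ℝ} (hf : Smooth f) (hg : Smooth g) :
    toGerm f hf = toGerm g hg ↔ f =ᶠ[𝓝 0] g := by
  rw [← Subtype.coe_inj]
  exact Germ.coe_eq

theorem exists_contDiff_toGerm (x : smoothGerms) :
    ∃ (f : Plane → ℝ) (hf : ContDiff ℝ ∞ f), toGerm f (smooth_of_contDiff hf) = x := by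
  obtain ⟨_, g, hg, rfl⟩ := x
  obtain ⟨f, hf, hfg⟩ := hg.exists_contDiff
  exact ⟨f, hf, (toGerm_eq_iff _ hg).2 hfg⟩

/-- Evaluation at the origin. -/
def evalZero : smoothGerms →+* ℝ := (Germ.valueRingHom (X := Plane) (x := 0)).comp smoothGerms.subtype

/-- The ideal of germs that vanish at the origin. -/
def vanishingIdeal : Ideal smoothGerms := RingHom.ker evalZero

theorem mem_vanishingIdeal (f : Plane → ℝ) (hf : Smooth f) :
    toGerm f hf ∈ vanishingIdeal ↔ f 0 = 0 := Iff.rfl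

theorem isUnit_of_evalZero_ne_zero {x : smoothGerms} (hx : evalZero x ≠ 0) : IsUnit x := by
  obtain ⟨f, hf, rfl⟩ := exists_contDiff_toGerm x
  have h0 : ∀ᶠ y in 𝓝 (0 : Plane), f y ≠ 0 := hf.continuous.continuousAt.eventually_ne hx
  have hi : Smooth fun y => (f y)⁻¹ := by
    filter_upwards [h0] with y hy using hf.contDiffAt.inv hy
  refine IsUnit.of_mul_eq_one (toGerm _ hi) ?_
  refine Subtype.ext (Germ.coe_eq.2 ?_)
  filter_upwards [h0] with y hy using mul_inv_cancel₀ hy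

/-- Expanding the multilinear form of the integral remainder in coordinates gives monomials of
degree `k + 1` times smooth parameter integrals. -/
theorem sub_jet_mem {f : Plane → ℝ} (hf : ContDiff ℝ ∞ f) (k : ℕ)
    (h : Smooth fun x => f x - jet k f x) :
    toGerm (fun x => f x - jet k f x) h ∈ vanishingIdeal ^ (k + 1) := by
  let c : Fin 2 → Plane → ℝ := ![Prod.fst, Prod.snd]
  let e : Fin 2 → Plane := ![(1, 0), (0, 1)]
  have hc : ∀ j, ContDiff ℝ ∞ (c j) := by
    intro j
    fin_cases j
    · exact contDiff_fst
    · exact contDiff_snd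
  have hx : ∀ x : Plane, x = ∑ j, c j x • e j := by
    intro x
    simp [c, e, Fin.sum_univ_two]
  let G : (Fin (k + 1) → Fin 2) → ℝ × Plane → ℝ := fun r q =>
    ((1 - q.1) ^ k / k.factorial) * iteratedFDeriv ℝ (k + 1) f (q.1 • q.2) fun i => e (r i)
  have hG : ∀ r, ContDiff ℝ ∞ (G r) := by
    intro r
    have h1 : ContDiff ℝ ∞ (iteratedFDeriv ℝ (k + 1) f) := hf.iteratedFDeriv_right (m := ∞)
      (by exact_mod_cast le_top)
    have h2 : ContDiff ℝ ∞ fun q : ℝ × Plane => iteratedFDeriv ℝ (k + 1) f (q.1 • q.2) :=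
      h1.comp (by fun_prop)
    exact ContDiff.mul (by fun_prop) ((ContinuousMultilinearMap.apply ℝ (fun _ : Fin (k + 1) => Plane)
      ℝ (fun i => e (r i))).contDiff.comp h2)
  let J : (Fin (k + 1) → Fin 2) → Plane → ℝ := fun r x => ∫ t in (0 : ℝ)..1, G r (t, x)
  have hJ : ∀ r, ContDiff ℝ ∞ (J r) := fun r => contDiff_integral (hG r)
  let cs : Fin 2 → smoothFunctions := fun j => ⟨c j, smooth_of_contDiff (hc j)⟩
  let Js : (Fin (k + 1) → Fin 2) → smoothFunctions := fun r => ⟨J r, smooth_of_contDiff (hJ r)⟩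
  have key : (⟨fun x => f x - jet k f x, h⟩ : smoothFunctions) =
      ∑ r : Fin (k + 1) → Fin 2, (∏ i, cs (r i)) * Js r := by
    apply Subtype.ext
    funext x
    have hexp : ∀ t : ℝ, ((1 - t) ^ k / k.factorial) *
        iteratedFDeriv ℝ (k + 1) f (t • x) (fun _ => x) =
          ∑ r : Fin (k + 1) → Fin 2, (∏ i, c (r i) x) * G r (t, x) := by
      intro t
      have h1 : (fun _ : Fin (k + 1) => x) = fun _ => ∑ j, c j x • e j := by
        funext _; exact hx x
      rw [h1, ContinuousMultilinearMap.map_sum, Finset.mul_sum]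
      refine Finset.sum_congr rfl fun r _ => ?_
      rw [ContinuousMultilinearMap.map_smul_univ]
      simp only [G, smul_eq_mul]
      ring
    simp only [sub_jet_eq_integral hf, hexp]
    rw [intervalIntegral.integral_finsetSum]
    · simp [cs, Js, J]
    · intro r _
      apply Continuous.intervalIntegrable
      have := (hG r).continuous
      fun_prop
  have key' := congrArg germHom key
  rw [map_sum] at key'
  change germHom ⟨fun x => f x - jet k f x, h⟩ ∈ _
  rw [key']
  refine Ideal.sum_mem _ fun r _ => ?_
  rw [map_mul, map_prod]
  refine Ideal.mul_mem_right _ _ ?_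
  have : ∀ i ∈ (Finset.univ : Finset (Fin (k + 1))), germHom (cs (r i)) ∈ vanishingIdeal := by
    intro i _
    change c (r i) 0 = 0
    generalize r i = j
    fin_cases j <;> rfl
  have := Ideal.prod_mem_prod this
  simpa using this

/-! ### Nakayama's lemma and the codimension -/

/-- In a finite-dimensional commutative algebra, an ideal inside the Jacobson radical is
nilpotent, with the dimension as a bound for the exponent. -/
theorem pow_finrank_eq_bot {K Q : Type*} [Field K] [CommRing Q] [Algebra K Q]
    [Module.Finite K Q] (n : Ideal Q) (hn : n ≤ Ideal.jacobson ⊥) :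
    n ^ Module.finrank K Q = ⊥ := by
  have hN : IsNoetherianRing Q := isNoetherian_of_tower K inferInstance
  -- Each strict inclusion in the chain of powers costs at least one dimension, and by Nakayama the
  -- chain can only become stationary at zero.
  have claim : ∀ i : ℕ, n ^ i = ⊥ ∨
      Module.finrank K ((n ^ i).restrictScalars K) + i ≤ Module.finrank K Q := by
    intro i
    induction i with
    | zero => exact Or.inr (by simpa using Submodule.finrank_le _)
    | succ i ih =>
      rcases ih with h | h
      · left
        rw [pow_succ, h, Ideal.bot_mul]
      · by_cases he : n ^ i ≤ n ^ (i + 1)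
        · left
          have : n ^ i = ⊥ := Submodule.eq_bot_of_le_smul_of_le_jacobson_bot n (n ^ i)
            (IsNoetherian.noetherian _) (by rw [smul_eq_mul, ← pow_succ']; exact he) hn
          rw [pow_succ, this, Ideal.bot_mul]
        · right
          have hlt : (n ^ (i + 1)).restrictScalars K < (n ^ i).restrictScalars K :=
            lt_of_le_not_ge (fun x hx => Ideal.pow_le_pow_right (Nat.le_succ i) hx) he
          have := Submodule.finrank_lt_finrank_of_lt hlt
          omega
  rcases claim (Module.finrank K Q) with h | h
  · exact h
  · have h0 : Module.finrank K ((n ^ Module.finrank K Q).restrictScalars K) = 0 := by omega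
    rw [Submodule.finrank_eq_zero] at h0
    exact (Submodule.restrictScalars_eq_bot_iff _ _ _).1 h0

theorem pow_le_of_rank_quotient_eq {K R : Type*} [Field K] [CommRing R] [Algebra K R]
    {J n : Ideal R} (hn : n ≤ Ideal.jacobson ⊥) {k : ℕ} (h : Module.rank K (R ⧸ J) = k) :
    n ^ k ≤ J := by
  have : Module.Finite K (R ⧸ J) :=
    Module.rank_lt_aleph0_iff.1 (h ▸ Cardinal.natCast_lt_aleph0)
  have hn' : n.map (Ideal.Quotient.mk J) ≤ Ideal.jacobson ⊥ := by
    rw [Ideal.map_le_iff_le_comap]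
    intro x hx
    rw [Ideal.mem_comap, Ideal.mem_jacobson_bot]
    intro y
    obtain ⟨y, rfl⟩ := Ideal.Quotient.mk_surjective y
    simpa using (Ideal.mem_jacobson_bot.1 (hn hx) y).map (Ideal.Quotient.mk J)
  have := pow_finrank_eq_bot (K := K) _ hn'
  rw [Module.finrank_eq_of_rank_eq h, ← Ideal.map_pow] at this
  intro x hx
  rw [← Ideal.Quotient.eq_zero_iff_mem, ← Ideal.mem_bot, ← this]
  exact Ideal.mem_map_of_mem _ hx

/-- For `x ∈ 𝔪` the germ `xy + 1` has value one at the origin, hence is a unit. -/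
theorem vanishingIdeal_le_jacobson : vanishingIdeal ≤ Ideal.jacobson ⊥ := by
  intro x hx
  rw [Ideal.mem_jacobson_bot]
  intro y
  have hx0 : evalZero x = 0 := hx
  exact isUnit_of_evalZero_ne_zero (by simp [hx0])

/-! ### Lie derivatives of germs -/

/-- The Lie derivative along `X` as an operator on germs. -/
theorem exists_lieGerm {X : Plane → Plane} (hX : Smooth X) :
    ∃ D : smoothGerms → smoothGerms, ∀ (f : Plane → ℝ) (hf : Smooth f),
      D (toGerm f hf) = toGerm (lieDeriv X f) (smooth_lieDeriv hX hf) := by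
  choose r hr hrg using exists_contDiff_toGerm
  refine ⟨fun g => toGerm (lieDeriv X (r g)) (smooth_lieDeriv hX (smooth_of_contDiff (hr g))),
    fun f hf => ?_⟩
  have h := (toGerm_eq_iff _ _).1 (hrg (toGerm f hf))
  rw [toGerm_eq_iff]
  filter_upwards [h.eventually_nhds] with x hx
  rw [lieDeriv, lieDeriv, Filter.EventuallyEq.fderiv_eq hx]

/-- Because `X 0 = 0`, the derivation sends every germ into `𝔪`; the Leibniz rule then loses no
order of vanishing. -/
theorem lieDeriv_mem_pow {X : Plane → Plane} (hX : Smooth X) (hX0 : X 0 = 0) (n : ℕ)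
    {f : Plane → ℝ} (hf : Smooth f) (hfn : toGerm f hf ∈ vanishingIdeal ^ n) :
    toGerm (lieDeriv X f) (smooth_lieDeriv hX hf) ∈ vanishingIdeal ^ n := by
  obtain ⟨D, hD⟩ := exists_lieGerm hX
  have hadd : ∀ x y, D (x + y) = D x + D y := by
    intro x y
    obtain ⟨f, hf, rfl⟩ := exists_contDiff_toGerm x
    obtain ⟨g, hg, rfl⟩ := exists_contDiff_toGerm y
    change D (toGerm (f + g) (smooth_of_contDiff (hf.add hg))) = _
    rw [hD, hD, hD]
    refine Subtype.ext (Germ.coe_eq.2 (Eventually.of_forall fun x => ?_))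
    simp only [lieDeriv]
    rw [fderiv_add (hf.differentiable (by simp) x) (hg.differentiable (by simp) x)]
    rfl
  have hmul : ∀ x y, D (x * y) = x * D y + y * D x := by
    intro x y
    obtain ⟨f, hf, rfl⟩ := exists_contDiff_toGerm x
    obtain ⟨g, hg, rfl⟩ := exists_contDiff_toGerm y
    change D (toGerm (f * g) (smooth_of_contDiff (hf.mul hg))) = _
    rw [hD, hD, hD]
    refine Subtype.ext (Germ.coe_eq.2 (Eventually.of_forall fun x => ?_))
    simp only [lieDeriv]
    rw [fderiv_mul (hf.differentiable (by simp) x) (hg.differentiable (by simp) x)]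
    rfl
  have h0 : ∀ x, D x ∈ vanishingIdeal := by
    intro x
    obtain ⟨f, hf, rfl⟩ := exists_contDiff_toGerm x
    rw [hD, mem_vanishingIdeal, lieDeriv, hX0, map_zero]
  have main : ∀ n : ℕ, ∀ x ∈ vanishingIdeal ^ n, D x ∈ vanishingIdeal ^ n := by
    intro n
    induction n with
    | zero => simp
    | succ n ih =>
      intro x hx
      rw [pow_succ] at hx
      refine Submodule.mul_induction_on hx (fun y hy z hz => ?_) fun y z hy hz => ?_
      · rw [hmul, pow_succ]
        refine Ideal.add_mem _ (Ideal.mul_mem_mul hy (h0 z)) ?_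
        rw [mul_comm z (D y)]
        exact Ideal.mul_mem_mul (ih y hy) hz
      · rw [hadd]
        exact Ideal.add_mem _ hy hz
  rw [← hD f hf]
  exact main n _ hfn

/-- Members of `𝔪 • ⟨f₁, f₂⟩` are combinations of `f₁`, `f₂` with coefficients in `𝔪`. -/
theorem exists_combination {f₁ f₂ p : Plane → ℝ} (h₁ : Smooth f₁) (h₂ : Smooth f₂) (hp : Smooth p)
    (h : toGerm p hp ∈ vanishingIdeal * Ideal.span {toGerm f₁ h₁, toGerm f₂ h₂}) :
    ∃ α β : Plane → ℝ, ContDiff ℝ ∞ α ∧ ContDiff ℝ ∞ β ∧ α 0 = 0 ∧ β 0 = 0 ∧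
      ∀ᶠ x in 𝓝 (0 : Plane), p x = α x * f₁ x + β x * f₂ x := by
  rw [Ideal.span_insert, Ideal.mul_sup, Submodule.mem_sup] at h
  obtain ⟨y, hy, z, hz, hyz⟩ := h
  obtain ⟨a, ha, rfl⟩ := Ideal.mem_mul_span_singleton.1 hy
  obtain ⟨b, hb, rfl⟩ := Ideal.mem_mul_span_singleton.1 hz
  obtain ⟨α, hα, rfl⟩ := exists_contDiff_toGerm a
  obtain ⟨β, hβ, rfl⟩ := exists_contDiff_toGerm b
  refine ⟨α, β, hα, hβ, ha, hb, ?_⟩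
  have h := congrArg Subtype.val hyz
  filter_upwards [Germ.coe_eq.1 h] with x hx using hx.symm

/-! ### Linear equations along paths -/

theorem eq_exp_integral_mul {y : ℝ → ℝ} (c : C(I, ℝ))
    (hy : ∀ t : I, HasDerivAt y (c t * y t) t) : y 1 = Real.exp (volterra c 1) * y 0 := by
  let C : ℝ → ℝ := fun t => ∫ s in (0 : ℝ)..t, extendPath c s
  have hC : ∀ t, HasDerivAt C (extendPath c t) t := fun t =>
    intervalIntegral.integral_hasDerivAt_right ((continuous_extendPath c).intervalIntegrable _ _)
      ((continuous_extendPath c).stronglyMeasurableAtFilter _ _) (continuous_extendPath c).continuousAt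
  have hz : ∀ t ∈ Set.Icc (0 : ℝ) 1, HasDerivAt (fun t => Real.exp (-C t) * y t) 0 t := by
    intro t ht
    have h := ((hC t).neg.exp).mul (hy ⟨t, ht⟩)
    refine h.congr_deriv ?_
    rw [extendPath_of_mem c ht]
    ring
  have h := constant_of_has_deriv_right_zero
    (fun t ht => (hz t ht).continuousAt.continuousWithinAt)
    (fun t ht => (hz t (Set.Ico_subset_Icc_self ht)).hasDerivWithinAt) 1 (by simp)
  have hC0 : C 0 = 0 := by simp [C]
  have hC1 : volterra c 1 = C 1 := rfl
  simp only [hC0, neg_zero, Real.exp_zero, one_mul] at h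
  rw [hC1, ← h, ← mul_assoc, ← Real.exp_add, add_neg_cancel, Real.exp_zero, one_mul]

/-- Passes from the integral equation to a differential one. Extending the integrand continuously
beyond `[0, 1]` makes the derivatives two-sided even at the end points. -/
theorem exists_primitive {F : Type*} [NormedAddCommGroup F] [NormedSpace ℝ F] [CompleteSpace F]
    {γ η : C(I, F)} {x : F} (h : γ = ContinuousMap.const I x + volterra η) :
    ∃ c : ℝ → F, c 0 = x ∧ (∀ t : I, c t = γ t) ∧ ∀ t : I, HasDerivAt c (η t) t := by
  refine ⟨fun t => x + ∫ s in (0 : ℝ)..t, extendPath η s, by simp, fun t => ?_, fun t => ?_⟩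
  · rw [h]; rfl
  · have := (intervalIntegral.integral_hasDerivAt_right (a := 0) (b := (t : ℝ))
      ((continuous_extendPath η).intervalIntegrable _ _)
      ((continuous_extendPath η).stronglyMeasurableAtFilter _ _)
      (continuous_extendPath η).continuousAt).const_add x
    rwa [extendPath_of_mem η t.2] at this

theorem eventually_forall_path {Γ : Plane → C(I, Plane)} (hΓ : ContinuousAt Γ 0) (h0 : Γ 0 = 0)
    {P : Plane → Prop} (hP : ∀ᶠ y in 𝓝 0, P y) : ∀ᶠ x in 𝓝 0, ∀ t, P (Γ x t) := by
  obtain ⟨r, hr, hP⟩ := Metric.eventually_nhds_iff_ball.1 hP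
  have hm := hΓ.eventually_mem (Metric.ball_mem_nhds (Γ 0) hr)
  rw [h0] at hm
  filter_upwards [hm] with x hx t
  exact hP _ ((ContinuousMap.dist_apply_le_dist t).trans_lt hx)

/-- The exponential of an integral along the paths `Γ x` is a non-vanishing germ. -/
theorem nonvanishingGerm_exp_volterra {Γ : Plane → C(I, Plane)}
    (hΓ : ∀ᶠ x in 𝓝 0, ContDiffAt ℝ ∞ Γ x) {G : ℝ × Plane → ℝ} (hG : ContDiff ℝ ∞ G) :
    NonvanishingGerm fun x => Real.exp (volterra (superpose G hG.continuous (Γ x)) 1) := by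
  refine ⟨?_, (Real.exp_pos _).ne'⟩
  filter_upwards [hΓ] with x hx
  let V : C(I, ℝ) →L[ℝ] C(I, ℝ) := volterra
  let ev : C(I, ℝ) →L[ℝ] ℝ := ContinuousMap.evalCLM ℝ (1 : I)
  have h1 : ContDiff ℝ ∞ fun γ : C(I, Plane) => ev (V (superpose G hG.continuous γ)) :=
    ev.contDiff.comp (V.contDiff.comp (contDiff_superpose hG))
  exact (h1.contDiffAt.comp x hx).exp

/-! ### Conformal flows and the homotopy method -/

/-- Cartan's formula in the plane: `ℒ_X a` is a multiple of `a`. -/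
theorem lie_form_eq {a : Plane → Plane →L[ℝ] ℝ} {X : Plane → Plane} {w μ : Plane → ℝ}
    (ha : ContDiff ℝ ∞ a) (hX : ContDiff ℝ ∞ X)
    (hμ : ∀ᶠ x in 𝓝 (0 : Plane),
      fderiv ℝ a x (1, 0) (0, 1) - fderiv ℝ a x (0, 1) (1, 0) = μ x * w x)
    (haX : ∀ᶠ x in 𝓝 (0 : Plane), ∀ v, a x v = w x * ((X x).1 * v.2 - (X x).2 * v.1)) :
    ∀ᶠ x in 𝓝 (0 : Plane), a x (X x) = 0 ∧
      ∀ v, fderiv ℝ a x (X x) v + a x (fderiv ℝ X x v) = μ x * a x v := by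
  have h0 : ∀ᶠ x in 𝓝 (0 : Plane), a x (X x) = 0 := by
    filter_upwards [haX] with x hx
    rw [hx]; ring
  filter_upwards [h0, h0.eventually_nhds, hμ, haX] with x hx hxe hμx hax
  refine ⟨hx, fun v => ?_⟩
  -- Differentiating `a(X) = 0` replaces `a(DX v)` by `-(Da v)(X)`, so that `ℒ_X a` becomes `da(X,
  -- ·)`.
  have h1 : HasFDerivAt (fun y => a y (X y)) 0 x :=
    (hasFDerivAt_const (𝕜 := ℝ) (0 : ℝ) x).congr_of_eventuallyEq hxe
  have h2 := ((ha.differentiable (by simp) x).hasFDerivAt).clm_apply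
    ((hX.differentiable (by simp) x).hasFDerivAt)
  have h3 := congrArg (fun A : Plane →L[ℝ] ℝ => A v) (h2.unique h1)
  replace h3 : a x (fderiv ℝ X x v) + fderiv ℝ a x v (X x) = 0 := h3
  have hB : ∀ v w : Plane, fderiv ℝ a x v w =
      v.1 * (w.1 * fderiv ℝ a x (1, 0) (1, 0) + w.2 * fderiv ℝ a x (1, 0) (0, 1)) +
      v.2 * (w.1 * fderiv ℝ a x (0, 1) (1, 0) + w.2 * fderiv ℝ a x (0, 1) (0, 1)) := by
    intro v w
    have hv : v = v.1 • ((1, 0) : Plane) + v.2 • ((0, 1) : Plane) := by ext <;> simp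
    have hw : w = w.1 • ((1, 0) : Plane) + w.2 • ((0, 1) : Plane) := by ext <;> simp
    conv_lhs => rw [hv, hw]
    simp only [map_add, map_smul, add_apply, smul_apply, smul_eq_mul]
    ring
  rw [hax v]
  have h4 := hB (X x) v
  have h5 := hB v (X x)
  linear_combination h3 + h4 - h5 + ((X x).1 * v.2 - (X x).2 * v.1) * hμx

/-- As `a(X) = 0`, the term with `du` drops out of `ℒ_{uX} a`, which equals `uμa`. Evaluating `a` on
a solution of the linearized equation therefore gives a scalar linear equation, and the conformal
factor is the exponential of `-∫ uμ` along the flow line. -/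
theorem exists_conformal_flow {a : Plane → Plane →L[ℝ] ℝ} {X : Plane → Plane} {μ : Plane → ℝ}
    {u : ℝ × Plane → ℝ} (ha : ContDiff ℝ ∞ a) (hX : ContDiff ℝ ∞ X) (hμ : ContDiff ℝ ∞ μ)
    (hu : ContDiff ℝ ∞ u) (hX0 : X 0 = 0) (hu0 : ∀ s, u (s, 0) = 0)
    (hL : ∀ᶠ x in 𝓝 (0 : Plane), a x (X x) = 0 ∧
      ∀ v, fderiv ℝ a x (X x) v + a x (fderiv ℝ X x v) = μ x * a x v)
    (hY : Continuous fun q : ℝ × Plane => u q • X q.2) :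
    ∃ Γ : Plane → C(I, Plane), (∀ᶠ x in 𝓝 0, ContDiffAt ℝ ∞ Γ x) ∧ Γ 0 = 0 ∧
      (∀ᶠ x in 𝓝 0, Γ x = ContinuousMap.const I x +
        volterra (superpose (fun q : ℝ × Plane => u q • X q.2) hY (Γ x))) ∧
      IsConformalEquiv a a (fun x => Γ x 1) := by
  let Y : ℝ × Plane → Plane := fun q => u q • X q.2
  have hYs : ContDiff ℝ ∞ Y := by fun_prop
  have hYd : ∀ (s : ℝ) (x v : Plane), partialSnd Y (s, x) v =
      u (s, x) • fderiv ℝ X x v + partialSnd u (s, x) v • X x := by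
    intro s x v
    have h1 := (hasFDerivAt_partialSnd hu s x).smul ((hX.differentiable (by simp) x).hasFDerivAt)
    have h2 := (hasFDerivAt_partialSnd hYs s x).unique h1
    rw [h2]
    simp
  obtain ⟨Γ, hΓ, hΓ0, hΓe, hΓd⟩ := exists_flow hYs (fun s => by simp [Y, hX0])
    (fun s => ContinuousLinearMap.ext fun v => by rw [hYd, hu0, hX0]; simp)
  refine ⟨Γ, hΓ, hΓ0, hΓe, ?_, ?_⟩
  · let ev : C(I, Plane) →L[ℝ] Plane := ContinuousMap.evalCLM ℝ (1 : I)
    have hφ : ∀ᶠ x in 𝓝 0, ContDiffAt ℝ ∞ (fun x => Γ x 1) x := by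
      filter_upwards [hΓ] with x hx using ev.contDiff.contDiffAt.comp x hx
    have hφd : HasFDerivAt (fun x => Γ x 1) (ContinuousLinearMap.id ℝ Plane) 0 := by
      have h1 : HasFDerivAt (fun x => Γ x 1) (ev.comp (fderiv ℝ Γ 0)) 0 :=
        ev.hasFDerivAt.comp 0 (hΓ.self_of_nhds.differentiableAt (by simp)).hasFDerivAt
      convert h1 using 1
      refine ContinuousLinearMap.ext fun v => ?_
      have h2 := hΓd.self_of_nhds v
      have h3 : superpose (partialSnd Y) (contDiff_partialSnd hYs).continuous (Γ 0) = 0 := by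
        ext s : 1
        rw [hΓ0, superpose_apply]
        refine ContinuousLinearMap.ext fun v => ?_
        rw [ContinuousMap.zero_apply, hYd, hu0, hX0]
        simp
      rw [h3, map_zero, zero_apply, map_zero, add_zero] at h2
      rw [ContinuousLinearMap.comp_apply, h2]
      rfl
    have hφ0 : Γ 0 1 = 0 := by rw [hΓ0]; rfl
    obtain ⟨ψ, h1, h2, h3, h4⟩ := exists_smooth_inverse hφ hφ0 hφd
    exact ⟨hφ, hφ0, ψ, h1, h2, h3, h4⟩
  · have hG : ContDiff ℝ ∞ fun q : ℝ × Plane => -(u q * μ q.2) := by fun_prop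
    refine ⟨_, nonvanishingGerm_exp_volterra hΓ hG, ?_⟩
    filter_upwards [hΓ, hΓe, hΓd,
      eventually_forall_path hΓ.self_of_nhds.continuousAt hΓ0 hL] with x hx hxe hxd hxL
    refine ContinuousLinearMap.ext fun v => ?_
    obtain ⟨c, hc0, hc, hcd⟩ := exists_primitive hxe
    obtain ⟨W, hW0, hW, hWd⟩ := exists_primitive (hxd v)
    have hφ : fderiv ℝ (fun x => Γ x 1) x v = W 1 := by
      let ev : C(I, Plane) →L[ℝ] Plane := ContinuousMap.evalCLM ℝ (1 : I)
      have h1 : HasFDerivAt (fun x => Γ x 1) (ev.comp (fderiv ℝ Γ x)) x :=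
        ev.hasFDerivAt.comp x
          (hx.differentiableAt (by simp)).hasFDerivAt
      rw [h1.fderiv]
      exact (hW 1).symm
    have hc1 : Γ x 1 = c 1 := (hc 1).symm
    have hode : ∀ t : I, HasDerivAt (fun t => a (c t) (W t))
        (superpose (fun q : ℝ × Plane => u q * μ q.2) (by fun_prop) (Γ x) t *
          a (c t) (W t)) t := by
      intro t
      have h1 := ((ha.differentiable (by simp) (c t)).hasFDerivAt).comp_hasDerivAt (t : ℝ) (hcd t)
      have h2 := h1.clm_apply (hWd t)
      refine h2.congr_deriv ?_
      rw [superpose_apply, superpose_apply, pathApply_apply, superpose_apply, hYd, ← hW, ← hc]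
      have h3 := hxL t
      rw [← hc] at h3
      simp only [map_add, map_smul, smul_eq_mul, smul_apply, Function.comp_apply, Y]
      rw [h3.1]
      linear_combination u ((t : ℝ), c t) * h3.2 (W t)
    have h1 := eq_exp_integral_mul _ hode
    have h2 : superpose (fun q : ℝ × Plane => -(u q * μ q.2)) hG.continuous (Γ x) =
        -superpose (fun q : ℝ × Plane => u q * μ q.2) (by fun_prop) (Γ x) := by
      ext t; rfl
    rw [smul_apply, pullbackForm, ContinuousLinearMap.comp_apply, hφ, hc1, h1,
      hc0, hW0, h2, map_neg, ContinuousMap.neg_apply, smul_eq_mul, ← mul_assoc, ← Real.exp_add,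
      neg_add_cancel, Real.exp_zero, one_mul]

/-- The homotopy method: a solution `(u, v)` of the infinitesimal equation along the segment from
`f` to `f + p` integrates to an equivalence. -/
theorem kEquiv_of_infinitesimal {a : Plane → Plane →L[ℝ] ℝ} {X : Plane → Plane} {f p μ : Plane → ℝ}
    {u v : ℝ × Plane → ℝ} (ha : ContDiff ℝ ∞ a) (hX : ContDiff ℝ ∞ X) (hμ : ContDiff ℝ ∞ μ)
    (hf : ContDiff ℝ ∞ f) (hp : ContDiff ℝ ∞ p)
    (hu : ContDiff ℝ ∞ u) (hv : ContDiff ℝ ∞ v) (hX0 : X 0 = 0) (hu0 : ∀ s, u (s, 0) = 0)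
    (hL : ∀ᶠ x in 𝓝 (0 : Plane), a x (X x) = 0 ∧
      ∀ v, fderiv ℝ a x (X x) v + a x (fderiv ℝ X x v) = μ x * a x v)
    (heq : ∀ᶠ x in 𝓝 (0 : Plane), ∀ t ∈ Set.Icc (0 : ℝ) 1,
      p x + u (t, x) * (lieDeriv X f x + t * lieDeriv X p x) + v (t, x) * (f x + t * p x) = 0) :
    KEquiv a a f (fun x => f x + p x) := by
  have hY : Continuous fun q : ℝ × Plane => u q • X q.2 := by fun_prop
  obtain ⟨Γ, hΓ, hΓ0, hΓe, hconf⟩ := exists_conformal_flow ha hX hμ hu hX0 hu0 hL hY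
  refine ⟨_, hconf, _, nonvanishingGerm_exp_volterra hΓ hv, ?_⟩
  filter_upwards [hΓe, eventually_forall_path hΓ.self_of_nhds.continuousAt hΓ0 heq]
    with x hxe hxeq
  obtain ⟨c, hc0, hc, hcd⟩ := exists_primitive hxe
  -- The infinitesimal equation says that `f + tp` has logarithmic derivative `-v` along the flow
  -- line.
  have hode : ∀ t : I, HasDerivAt (fun t => f (c t) + t * p (c t))
      ((-superpose v hv.continuous (Γ x)) t * (f (c t) + t * p (c t))) t := by
    intro t
    have h1 := ((hf.differentiable (by simp) (c t)).hasFDerivAt).comp_hasDerivAt (t : ℝ) (hcd t)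
    have h2 := ((hp.differentiable (by simp) (c t)).hasFDerivAt).comp_hasDerivAt (t : ℝ) (hcd t)
    refine (h1.add ((hasDerivAt_id (t : ℝ)).mul h2)).congr_deriv ?_
    have h3 := hxeq t t t.2
    rw [ContinuousMap.neg_apply, superpose_apply, superpose_apply]
    rw [← hc] at h3 ⊢
    simp only [lieDeriv] at h3
    simp only [map_smul, smul_eq_mul, Function.comp_apply, id]
    linear_combination h3
  have h1 := eq_exp_integral_mul _ hode
  have hc1 : Γ x 1 = c 1 := (hc 1).symm
  simp only [one_mul, zero_mul, add_zero, hc0] at h1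
  rw [hc1, h1, map_neg, ContinuousMap.neg_apply, ← mul_assoc, ← Real.exp_add, add_neg_cancel,
    Real.exp_zero, one_mul]

/-! ### From equivalence of functions to conjugacy of fields -/

theorem IsDiffeoGerm.tendsto {φ : Plane → Plane} (hφ : IsDiffeoGerm φ) :
    Tendsto φ (𝓝 0) (𝓝 0) := by
  have := hφ.1.self_of_nhds.continuousAt.tendsto
  rwa [hφ.2.1] at this

theorem Smooth.comp_diffeo {F : Type*} [NormedAddCommGroup F] [NormedSpace ℝ F] {g : Plane → F}
    (hg : Smooth g) {φ : Plane → Plane} (hφ : IsDiffeoGerm φ) : Smooth fun x => g (φ x) := by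
  filter_upwards [hφ.tendsto.eventually hg, hφ.1] with x h1 h2 using h1.comp x h2

theorem KEquiv.congr {a a' : Plane → Plane →L[ℝ] ℝ} {f f' g g' : Plane → ℝ}
    (h : KEquiv a a f g) (ha : a =ᶠ[𝓝 0] a') (hf : f =ᶠ[𝓝 0] f') (hg : g =ᶠ[𝓝 0] g') :
    KEquiv a' a' f' g' := by
  obtain ⟨φ, ⟨hφ, κ, hκ, hκa⟩, h, hh, hfg⟩ := h
  refine ⟨φ, ⟨hφ, κ, hκ, ?_⟩, h, hh, ?_⟩
  · filter_upwards [hκa, ha, hφ.tendsto.eventually ha] with x h1 h2 h3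
    rw [← h2, h1, pullbackForm, pullbackForm, h3]
  · filter_upwards [hfg, hf, hφ.tendsto.eventually hg] with x h1 h2 h3
    rw [← h2, h1, h3]

theorem kEquiv_one {a : Plane → Plane →L[ℝ] ℝ} {f : Plane → ℝ} (hf : Smooth f) (hf0 : f 0 ≠ 0) :
    KEquiv a a f fun _ => 1 := by
  have hid : Smooth (id : Plane → Plane) := smooth_of_contDiff contDiff_id
  refine ⟨id, ⟨⟨hid, rfl, id, hid, rfl, Eventually.of_forall fun _ => rfl,
    Eventually.of_forall fun _ => rfl⟩, fun _ => 1,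
    ⟨smooth_of_contDiff contDiff_const, one_ne_zero⟩, Eventually.of_forall fun x => ?_⟩,
    f, ⟨hf, hf0⟩, Eventually.of_forall fun x => (mul_one _).symm⟩
  simp [pullbackForm]

theorem codim_eq_zero {Ω : Plane → Plane [⋀^Fin 2]→L[ℝ] ℝ} {a : Plane → Plane →L[ℝ] ℝ}
    {f : Plane → ℝ} (hΩ : IsVolumeForm Ω) (ha : Smooth a) (hf : Smooth f) (hf0 : f 0 ≠ 0) :
    codim hΩ ha hf = 0 := by
  have hu : IsUnit (toGerm f hf) := isUnit_of_evalZero_ne_zero hf0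
  have ht : tangentIdeal hΩ ha hf = ⊤ :=
    Ideal.eq_top_of_isUnit_mem _ (Ideal.subset_span (Set.mem_insert _ _)) hu
  have : Subsingleton (smoothGerms ⧸ tangentIdeal hΩ ha hf) :=
    Ideal.Quotient.subsingleton_iff.2 ht
  exact rank_subsingleton' ℝ _

theorem IsVolumeForm.smooth_basis {Ω : Plane → Plane [⋀^Fin 2]→L[ℝ] ℝ} (hΩ : IsVolumeForm Ω) :
    Smooth fun x => Ω x ![(1, 0), (0, 1)] := by
  filter_upwards [hΩ.1] with x hx
  exact (ContinuousAlternatingMap.apply ℝ Plane ℝ ![(1, 0), (0, 1)]).contDiff.contDiffAt.comp x hx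

theorem form_eq_wedge {Ω : Plane → Plane [⋀^Fin 2]→L[ℝ] ℝ} (hΩ : IsVolumeForm Ω)
    (a : Plane → Plane →L[ℝ] ℝ) :
    ∀ᶠ x in 𝓝 (0 : Plane), ∀ v : Plane, a x v = Ω x ![(1, 0), (0, 1)] *
      ((assocField Ω a x).1 * v.2 - (assocField Ω a x).2 * v.1) := by
  filter_upwards [volume_assocField hΩ a] with x hx v
  rw [← hx v, twoForm_apply]

/-- The factor is the determinant of `A`. -/
theorem wedge_map (A : Plane →L[ℝ] Plane) (v w : Plane) :
    (A v).1 * (A w).2 - (A v).2 * (A w).1 =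
      ((A (1, 0)).1 * (A (0, 1)).2 - (A (1, 0)).2 * (A (0, 1)).1) * (v.1 * w.2 - v.2 * w.1) := by
  have hA : ∀ v : Plane, A v = v.1 • A (1, 0) + v.2 • A (0, 1) := by
    intro v
    have hv : v = v.1 • ((1, 0) : Plane) + v.2 • ((0, 1) : Plane) := by ext <;> simp
    conv_lhs => rw [hv, map_add, map_smul, map_smul]
  rw [hA v, hA w]
  simp only [Prod.fst_add, Prod.snd_add, Prod.smul_fst, Prod.smul_snd, smul_eq_mul]
  ring

/-- The field `X_a` is preserved, up to a non-vanishing factor, by the conformal symmetries of `a`;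
hence equivalent functions give conjugate fields. -/
theorem KEquiv.orbitallyConj {Ω : Plane → Plane [⋀^Fin 2]→L[ℝ] ℝ} (hΩ : IsVolumeForm Ω)
    {a : Plane → Plane →L[ℝ] ℝ} {f g : Plane → ℝ} (h : KEquiv a a f g) {X : Plane → Plane}
    (hX : ∀ᶠ x in 𝓝 (0 : Plane), X x = f x • assocField Ω a x) :
    OrbitallyConj a a X fun x => g x • assocField Ω a x := by
  obtain ⟨φ, ⟨hφ, κ, hκ, hκa⟩, h, hh, hfg⟩ := h
  refine ⟨φ, ⟨hφ, κ, hκ, hκa⟩, ?_⟩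
  obtain ⟨hφs, hφ0, ψ, hψ, hψ0, hψφ, hφψ⟩ := id hφ
  let w : Plane → ℝ := fun x => Ω x ![(1, 0), (0, 1)]
  have hw : Smooth w := hΩ.smooth_basis
  have hw0 : ∀ᶠ x in 𝓝 (0 : Plane), w x ≠ 0 := hΩ.eventually_basis_ne_zero
  let d : Plane → ℝ := fun x => (fderiv ℝ φ x (1, 0)).1 * (fderiv ℝ φ x (0, 1)).2 -
    (fderiv ℝ φ x (1, 0)).2 * (fderiv ℝ φ x (0, 1)).1
  have hd : Smooth d := by
    filter_upwards [hφs] with x hx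
    have h1 : ContDiffAt ℝ ∞ (fderiv ℝ φ) x := hx.fderiv_right (m := ∞) (by simp)
    have h2 : ∀ v, ContDiffAt ℝ ∞ (fun y => fderiv ℝ φ y v) x :=
      fun v => h1.clm_apply contDiffAt_const
    exact ((h2 _).fst.mul (h2 _).snd).sub ((h2 _).snd.mul (h2 _).fst)
  have hinv : ∀ᶠ x in 𝓝 (0 : Plane),
      (fderiv ℝ ψ (φ x)).comp (fderiv ℝ φ x) = ContinuousLinearMap.id ℝ Plane ∧
      (fderiv ℝ φ x).comp (fderiv ℝ ψ (φ x)) = ContinuousLinearMap.id ℝ Plane := by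
    filter_upwards [hφs, hφ.tendsto.eventually hψ, hψφ.eventually_nhds,
      hφ.tendsto.eventually hφψ.eventually_nhds] with x h1 h2 h3 h4
    have h5 := (h1.differentiableAt (by simp)).hasFDerivAt
    have h6 := (h2.differentiableAt (by simp)).hasFDerivAt
    have hx : ψ (φ x) = x := h3.self_of_nhds
    refine ⟨((h6.comp x h5).congr_of_eventuallyEq (f₁ := id) ?_).unique (hasFDerivAt_id x), ?_⟩
    · filter_upwards [h3] with y hy using hy.symm
    · have h7 : HasFDerivAt φ (fderiv ℝ φ x) (ψ (φ x)) := by rwa [hx]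
      refine ((h7.comp (φ x) h6).congr_of_eventuallyEq (f₁ := id) ?_).unique (hasFDerivAt_id _)
      filter_upwards [h4] with y hy using hy.symm
  have hd0 : d 0 ≠ 0 := by
    intro h0
    have h1 := hinv.self_of_nhds.1
    have h2 : ∀ v, fderiv ℝ ψ (φ 0) (fderiv ℝ φ 0 v) = v := fun v =>
      congrArg (fun A : Plane →L[ℝ] Plane => A v) h1
    have h3 := wedge_map (fderiv ℝ ψ (φ 0)) (fderiv ℝ φ 0 (1, 0)) (fderiv ℝ φ 0 (0, 1))
    rw [h2, h2] at h3
    change _ = _ * d 0 at h3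
    rw [h0] at h3
    simp at h3
  -- With `Y = φ^*X_a`, the relation `a = κ φ^*a` reads `w (X_a ∧ v) = κ (w ∘ φ) d (Y ∧ v)` for all
  -- `v`, where `d = det Dφ`; this determines the ratio of `X_a` to `Y`.
  refine ⟨fun x => h x * (κ x * w (φ x) * d x / w x), ⟨?_, ?_⟩, ?_⟩
  · filter_upwards [hh.1, hκ.1, hw.comp_diffeo hφ, hd, hw, hw0] with x h1 h2 h3 h4 h5 h6
    exact h1.mul (((h2.mul h3).mul h4).div h5 h6)
  · have h1 := hw0.self_of_nhds
    refine mul_ne_zero hh.2 (div_ne_zero (mul_ne_zero (mul_ne_zero hκ.2 ?_) hd0) h1)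
    rwa [hφ0]
  · filter_upwards [hX, hfg, hinv, hκa, hw0, form_eq_wedge hΩ a,
      hφ.tendsto.eventually (form_eq_wedge hΩ a)] with x h1 h2 h3 h4 h5 h6 h7
    have hAB : (fderiv ℝ φ x).inverse = fderiv ℝ ψ (φ x) :=
      ContinuousLinearMap.inverse_eq h3.2 h3.1
    have hY : ∀ z, fderiv ℝ φ x (fderiv ℝ ψ (φ x) z) = z := fun z =>
      congrArg (fun A : Plane →L[ℝ] Plane => A z) h3.2
    set Y := fderiv ℝ ψ (φ x) (assocField Ω a (φ x)) with hYdef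
    have h8 : ∀ v : Plane, w x * ((assocField Ω a x).1 * v.2 - (assocField Ω a x).2 * v.1) =
        κ x * w (φ x) * d x * (Y.1 * v.2 - Y.2 * v.1) := by
      intro v
      have e1 := h6 v
      rw [h4] at e1
      change κ x * a (φ x) (fderiv ℝ φ x v) = _ at e1
      have e2 := wedge_map (fderiv ℝ φ x) Y v
      rw [hYdef, hY, ← hYdef] at e2
      rw [h7, e2] at e1
      rw [← e1]
      simp only [w, d]
      ring
    have h9 : assocField Ω a x = (κ x * w (φ x) * d x / w x) • Y := by
      have e1 := h8 (0, 1)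
      have e2 := h8 (1, 0)
      simp only [mul_one, mul_zero, sub_zero, zero_sub, mul_neg, neg_inj] at e1 e2
      ext
      · rw [Prod.smul_fst, smul_eq_mul, div_mul_eq_mul_div, eq_div_iff h5, mul_comm, e1]
      · rw [Prod.smul_snd, smul_eq_mul, div_mul_eq_mul_div, eq_div_iff h5, mul_comm, e2]
    rw [h1, h2, VectorField.pullback, hAB, map_smul, ← hYdef, h9, smul_smul, smul_smul]
    congr 1
    ring

/-! ### Finite determinacy -/

/-- A cut-off reciprocal: dividing by the Cramer determinant must give coefficients smooth on all of
`ℝ × Plane`. -/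
theorem exists_smooth_inv_near_one :
    ∃ ψ : ℝ → ℝ, ContDiff ℝ ∞ ψ ∧ ∀ y, |y - 1| ≤ 1 / 2 → ψ y * y = 1 := by
  let b : ContDiffBump (1 : ℝ) := ⟨1 / 2, 3 / 4, by norm_num, by norm_num⟩
  refine ⟨fun y => b y * y⁻¹, contDiff_iff_contDiffAt.2 fun y => ?_, fun y hy => ?_⟩
  · by_cases hy : y = 0
    · have h0 : (fun y => b y * y⁻¹) =ᶠ[𝓝 y] fun _ => 0 := by
        have : ∀ᶠ z in 𝓝 y, dist z y < 1 / 4 := Metric.ball_mem_nhds y (by norm_num)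
        filter_upwards [this] with z hz
        rw [b.zero_of_le_dist, zero_mul]
        rw [hy, Real.dist_eq, sub_zero] at hz
        rw [Real.dist_eq]
        change 3 / 4 ≤ |z - 1|
        rw [abs_lt] at hz
        rw [abs_sub_comm]
        exact le_trans (by linarith) (le_abs_self _)
      exact contDiffAt_const.congr_of_eventuallyEq h0
    · exact b.contDiff.contDiffAt.mul (contDiffAt_id.inv hy)
  · have hy0 : y ≠ 0 := by
      rintro rfl
      norm_num at hy
    have h1 : b y = 1 := b.one_of_mem_closedBall (by rwa [Metric.mem_closedBall, Real.dist_eq])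
    simp only [h1, one_mul]
    exact inv_mul_cancel₀ hy0

/-- Finite determinacy: adding an element of `𝔪^(k+1)` to a function of codimension `k` does not
change its class. -/
theorem kEquiv_of_sub_mem {Ω : Plane → Plane [⋀^Fin 2]→L[ℝ] ℝ} (hΩ : IsVolumeForm Ω)
    {a : Plane → Plane →L[ℝ] ℝ} (ha : Smooth a) (ha0 : a 0 = 0) {f g : Plane → ℝ}
    (hf : Smooth f) {k : ℕ} (hk : codim hΩ ha hf = k)
    (hp : Smooth fun x => g x - f x) (hpk : toGerm _ hp ∈ vanishingIdeal ^ (k + 1)) :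
    KEquiv a a f g := by
  have hX := smooth_assocField hΩ ha
  have hX0 : assocField Ω a 0 = 0 := by simp [assocField, ha0]
  -- The power `k + 1` rather than `k` leaves a spare factor `𝔪`: it makes the coefficients vanish
  -- at the origin, so that the field vanishes to second order there and the determinant `d` equals
  -- one.
  have hI : vanishingIdeal ^ (k + 1) ≤ vanishingIdeal * tangentIdeal hΩ ha hf := by
    rw [pow_succ']
    exact Ideal.mul_mono_right (pow_le_of_rank_quotient_eq vanishingIdeal_le_jacobson hk)
  obtain ⟨α, β, hα, hβ, hα0, hβ0, hαβ⟩ :=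
    exists_combination hf (smooth_lieDeriv hX hf) hp (hI hpk)
  obtain ⟨γ, δ, hγ, hδ, hγ0, hδ0, hγδ⟩ :=
    exists_combination hf (smooth_lieDeriv hX hf) (smooth_lieDeriv hX hp)
      (hI (lieDeriv_mem_pow hX hX0 _ hp hpk))
  obtain ⟨a', ha', haa⟩ := ha.exists_contDiff
  obtain ⟨X', hX', hXX⟩ := hX.exists_contDiff
  obtain ⟨f', hf', hff⟩ := hf.exists_contDiff
  obtain ⟨p', hp', hpp⟩ := hp.exists_contDiff
  have hw0 := hΩ.eventually_basis_ne_zero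
  have hμ : Smooth fun x => (fderiv ℝ a' x (1, 0) (0, 1) - fderiv ℝ a' x (0, 1) (1, 0)) /
      Ω x ![(1, 0), (0, 1)] := by
    have h1 : ContDiff ℝ ∞ (fderiv ℝ a') := ha'.fderiv_right (m := ∞) (by simp)
    have h2 : ∀ v w, ContDiff ℝ ∞ fun x => fderiv ℝ a' x v w := fun v w =>
      (h1.clm_apply contDiff_const).clm_apply contDiff_const
    filter_upwards [hΩ.smooth_basis, hw0] with x hx hx0
    exact ((h2 _ _).sub (h2 _ _)).contDiffAt.div hx hx0
  obtain ⟨μ, hμs, hμe⟩ := hμ.exists_contDiff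
  have hL := lie_form_eq (w := fun x => Ω x ![(1, 0), (0, 1)]) (μ := μ) ha' hX'
    (by filter_upwards [hμe, hw0] with x hx hx0
        rw [hx, div_mul_cancel₀ _ hx0])
    (by filter_upwards [form_eq_wedge hΩ a, haa, hXX] with x hx h1 h2 v
        rw [h1, h2, hx v])
  obtain ⟨ψ, hψ, hψ1⟩ := exists_smooth_inv_near_one
  -- Determinant of the matrix expressing `f + tp` and `ℒ_X(f + tp)` through `f` and `ℒ_X f`.
  let d : ℝ × Plane → ℝ := fun q =>
    (1 + q.1 * α q.2) * (1 + q.1 * δ q.2) - q.1 ^ 2 * (β q.2 * γ q.2)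
  have hd : ContDiff ℝ ∞ d := by fun_prop
  have hdn : ∀ᶠ x in 𝓝 (0 : Plane), ∀ t ∈ Set.Icc (0 : ℝ) 1, |d (t, x) - 1| ≤ 1 / 2 := by
    refine isCompact_Icc.eventually_forall_of_forall_eventually fun t _ => ?_
    have hc : Continuous fun z : Plane × ℝ => |d (z.2, z.1) - 1| := by
      have := hd.continuous
      fun_prop
    refine (hc.continuousAt.eventually_lt (g := fun _ => 1 / 2) continuousAt_const ?_).mono
      fun _ hz => hz.le
    simp [d, hα0, hβ0, hγ0, hδ0]
  have hLf : lieDeriv X' f' =ᶠ[𝓝 0] lieDeriv (assocField Ω a) f := by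
    filter_upwards [hXX, hff.eventually_nhds] with x h1 h2
    rw [lieDeriv, lieDeriv, h1, Filter.EventuallyEq.fderiv_eq h2]
  have hLp : lieDeriv X' p' =ᶠ[𝓝 0] lieDeriv (assocField Ω a) fun x => g x - f x := by
    filter_upwards [hXX, hpp.eventually_nhds] with x h1 h2
    rw [lieDeriv, lieDeriv, h1, Filter.EventuallyEq.fderiv_eq h2]
  -- The choices of `u` and `v` are Cramer's solution, with `ψ (d q)` in place of `1 / d q`.
  have main := kEquiv_of_infinitesimal (a := a') (X := X') (f := f') (p := p') (μ := μ)
    (u := fun q => -(β q.2 * ψ (d q)))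
    (v := fun q => -((α q.2 + q.1 * (α q.2 * δ q.2 - β q.2 * γ q.2)) * ψ (d q)))
    ha' hX' hμs hf' hp' (by fun_prop) (by fun_prop) (hXX.eq_of_nhds.trans hX0)
    (fun s => by simp [hβ0]) hL
    (by
      filter_upwards [hαβ, hγδ, hpp, hff, hLf, hLp, hdn] with x h1 h2 h3 h4 h5 h6 h7 t ht
      have h8 := hψ1 _ (h7 t ht)
      rw [h3, h4, h5, h6, h1, h2]
      simp only [d] at h8 ⊢
      linear_combination (-(α x * f x + β x * lieDeriv (assocField Ω a) f x)) * h8)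
  refine main.congr haa hff ?_
  filter_upwards [hff, hpp] with x h1 h2
  rw [h1, h2]
  ring

theorem sub_jet_mem_of_smooth {f : Plane → ℝ} (hf : Smooth f) (k : ℕ)
    (h : Smooth fun x => f x - jet k f x) :
    toGerm (fun x => f x - jet k f x) h ∈ vanishingIdeal ^ (k + 1) := by
  obtain ⟨f', hf', hff⟩ := hf.exists_contDiff
  have hj : jet k f' = jet k f := by
    funext x
    refine Finset.sum_congr rfl fun i _ => ?_
    rw [(hff.iteratedFDeriv ℝ i).eq_of_nhds]
  have h' : Smooth fun x => f' x - jet k f' x := smooth_of_contDiff (hf'.sub (contDiff_jet k f'))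
  have he : toGerm (fun x => f x - jet k f x) h = toGerm _ h' := by
    rw [toGerm_eq_iff]
    filter_upwards [hff] with x hx
    rw [hj, hx]
  rw [he]
  exact sub_jet_mem hf' k h'

end PlaneGerm

end

/-! ### The theorem on singular 1-forms -/

open PlaneGerm
theorem mainTheorem2
    (Ω : Plane → Plane [⋀^Fin 2]→L[ℝ] ℝ) (hΩ : IsVolumeForm Ω)
    (a : Plane → Plane →L[ℝ] ℝ) (ha : Smooth a) (ha0 : a 0 = 0)
    (f : Plane → ℝ) (hf : Smooth f)
    (X : Plane → Plane) (hX : ∀ᶠ x in 𝓝 (0 : Plane), X x = f x • assocField Ω a x) :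
    (f 0 ≠ 0 →
      OrbitallyConj a a X (assocField Ω a) ∧
      codim hΩ ha hf = 0 ∧
      ∀ (g : Plane → ℝ) (hg : Smooth g), KEquiv a a g f → codim hΩ ha hg = 0) ∧
    (∀ k : ℕ, f 0 = 0 → codim hΩ ha hf = (k : Cardinal) →
      KEquiv a a f (jet k f) ∧
      OrbitallyConj a a X (fun x => jet k f x • assocField Ω a x) ∧
      ∀ g : Plane → ℝ, Smooth g → jet k g = jet k f → KEquiv a a f g) := by
  have hsub : ∀ {g₁ g₂ : Plane → ℝ}, Smooth g₁ → Smooth g₂ → Smooth fun x => g₁ x - g₂ x := by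
    intro g₁ g₂ h₁ h₂
    filter_upwards [h₁, h₂] with x h1 h2 using h1.sub h2
  refine ⟨fun hf0 => ⟨?_, codim_eq_zero hΩ ha hf hf0, fun g hg hgf => ?_⟩, fun k _ hk => ?_⟩
  · simpa using (kEquiv_one hf hf0).orbitallyConj hΩ hX
  · refine codim_eq_zero hΩ ha hg ?_
    obtain ⟨φ, hφ, h, hh, hgf⟩ := hgf
    rw [hgf.self_of_nhds, hφ.1.2.1]
    exact mul_ne_zero hh.2 hf0
  · have hj : Smooth (jet k f) := smooth_of_contDiff (contDiff_jet k f)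
    have hfj := sub_jet_mem_of_smooth hf k (hsub hf hj)
    have hK : KEquiv a a f (jet k f) := by
      refine kEquiv_of_sub_mem hΩ ha ha0 hf hk (hsub hj hf) ?_
      rw [← neg_mem_iff]
      convert hfj using 1
      exact Subtype.ext (Germ.coe_eq.2 (Eventually.of_forall fun x => neg_sub _ _))
    refine ⟨hK, hK.orbitallyConj hΩ hX, fun g hg hgf => ?_⟩
    -- The jets being equal, `g - f` is the difference of two Taylor remainders.
    refine kEquiv_of_sub_mem hΩ ha ha0 hf hk (hsub hg hf) ?_
    have hgj := sub_jet_mem_of_smooth hg k (hsub hg (smooth_of_contDiff (contDiff_jet k g)))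
    convert sub_mem hgj hfj using 1
    refine Subtype.ext (Germ.coe_eq.2 (Eventually.of_forall fun x => ?_))
    change g x - f x = (g x - jet k g x) - (f x - jet k f x)
    rw [hgf]
    ring
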